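/- **Setting.** Let $P(\alpha,\beta)=\sum_{i=0}^k\alpha^i\beta^{k-i}B_i$ with $B_i\in\mathbb C^{n\times n}$ be a homogeneous matrix polynomial of grade $k$, and let $\omega_0,\dots,\omega_k\ge 0$ be weights. A vector $(\alpha,\beta)\ne(0,0)$ represents an eigenvalue of $P$ (a line in $\mathbb C^2$) if $P(\alpha,\beta)x=0$ for some $x\neq0$; the eigenvalue represented by $(\alpha_0,\beta_0)\neq(0,0)$ is simple if the linear form $\beta_0\alpha-\alpha_0\beta$ divides the polynomial $\det P(\alpha,\beta)$ exactly once (so that $P$ is regular, i.e. $\det P(\alpha,\beta)\not\equiv0$). Let $\|\cdot\|_2$ be the Euclidean norm of vectors and the spectral norm of matrices, and let $\chi(u,w)=\sin\arccos\frac{|\langle u,w\rangle|}{\|u\|_2\|w\|_2}$ be the chordal distance between the lines spanned by nonzero $u,w\in\mathbb C^2$. **Stewart–Sun condition number.** For a simple eigenvalue $(\alpha_0,\beta_0)$ of $P$, $$\kappa_\theta((\alpha_0,\beta_0),P)=\lim_{\epsilon\to0^+}\sup\Big\{\tfrac1\epsilon\,\chi\big((\alpha_0,\beta_0),(\tilde\alpha,\tilde\beta)\big)\Big\},$$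 the supremum being over all $\Delta P(\alpha,\beta)=\sum_{i=0}^k\alpha^i\beta^{k-i}\Delta B_i$ with $\|\Delta B_i\|_2\le\epsilon\,\omega_i$ for $i=0,\dots,k$ and over the eigenvalues $(\tilde\alpha,\tilde\beta)$ of $P+\Delta P$ with $\chi((\alpha_0,\beta_0),(\tilde\alpha,\tilde\beta))<\delta$; here $\delta>0$ is fixed and small, which selects the eigenvalue that approaches $(\alpha_0,\beta_0)$, and the limit is the same for all sufficiently small $\delta$. **Dedieu–Tisseur condition number.** For a simple eigenvalue $v=(\alpha_0,\beta_0)$ of $P$, let $G$ be a map that sends each coefficient tuple $(B_0',\dots,B_k')$ near $(B_0,\dots,B_k)$ to a representative in $v+v^\perp$ of an eigenvalue of $\sum_{i=0}^k\alpha^i\beta^{k-i}B_i'$, that sends $(B_0,\dots,B_k)$ to $v$, and that is complex differentiable at $(B_0,\dots,B_k)$, with differential $K$ there (the condition operator, with values in the tangent space $v^\perp$ of the projective line at $v$). Then $$\kappa_h((\alpha_0,\beta_0),P)=\sup\Big\{\frac{\|K(\Delta B_0,\dots,\Delta B_k)\|_2}{\|v\|_2}:\ \sum_{i=0}^k\frac{\|\Delta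 B_i\|_2^2}{\omega_i^2}\le1\Big\},$$ where $\omega_i=0$ means that $\Delta B_i=0$ and that the term is omitted. **Theorem.** Let $(\alpha_0,\beta_0)\ne(0,0)$ be a simple eigenvalue of $P(\alpha,\beta)=\sum_{i=0}^k\alpha^i\beta^{k-i}B_i$. Then both condition numbers, taken with the same weights $\omega_i$, exist, are finite and are uniquely determined, and $$\kappa_h((\alpha_0,\beta_0),P)=\frac{\left(\sum_{i=0}^k|\alpha_0|^{2i}|\beta_0|^{2(k-i)}\omega_i^2\right)^{1/2}}{\sum_{i=0}^k|\alpha_0|^i|\beta_0|^{k-i}\omega_i}\;\kappa_\theta((\alpha_0,\beta_0),P).$$ (The quotient is read as $0$ if its denominator vanishes.) -/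

import Mathlib

open scoped Matrix.Norms.L2Operator Topology

noncomputable section

namespace HomMatPoly

/-- The coefficient tuples `(B_0, …, B_k)` of the `n × n` complex homogeneous matrix polynomials of
grade `k`. Matrices carry the spectral norm (the operator norm for the Euclidean vector norms). -/
abbrev Coeffs (n k : ℕ) : Type := Fin (k + 1) → Matrix (Fin n) (Fin n) ℂ

/-- The value `P(α, β) = ∑ i, α ^ i β ^ (k - i) B_i` at `v = (α, β)`. -/
def value {n k : ℕ} (B : Coeffs n k) (v : EuclideanSpace ℂ (Fin 2)) : Matrix (Fin n) (Fin n) ℂ :=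
  ∑ i : Fin (k + 1), (v 0 ^ (i : ℕ) * v 1 ^ (k - (i : ℕ))) • B i

/-- `v ≠ 0` represents an eigenvalue (a line of `ℂ²`) of `P`: there is a right eigenvector. -/
def IsEigenvalue {n k : ℕ} (B : Coeffs n k) (v : EuclideanSpace ℂ (Fin 2)) : Prop :=
  v ≠ 0 ∧ ∃ x : Fin n → ℂ, x ≠ 0 ∧ (value B v).mulVec x = 0

/-- The binary form `det P(α, β)`, as a polynomial in the two indeterminates `X 0 = α`,
`X 1 = β`. -/
def detForm {n k : ℕ} (B : Coeffs n k) : MvPolynomial (Fin 2) ℂ :=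
  (∑ i : Fin (k + 1),
    ((MvPolynomial.X 0 ^ (i : ℕ) * MvPolynomial.X 1 ^ (k - (i : ℕ)) : MvPolynomial (Fin 2) ℂ)) •
      (B i).map (MvPolynomial.C : ℂ →+* MvPolynomial (Fin 2) ℂ)).det

/-- `v = (α₀, β₀) ≠ 0` represents a simple eigenvalue: the linear form `β₀ α - α₀ β`, whose zero
set is the line of `v`, divides `det P(α, β)` exactly once. (In particular `det P(α, β)` is not the
zero polynomial, that is, `P` is regular, since every power divides zero.) -/
def IsSimpleEigenvalue {n k : ℕ} (B : Coeffs n k) (v : EuclideanSpace ℂ (Fin 2)) : Prop :=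
  v ≠ 0 ∧
    emultiplicity
      (MvPolynomial.C (v 1) * MvPolynomial.X 0 - MvPolynomial.C (v 0) * MvPolynomial.X 1)
      (detForm B) = 1

/-- The angle between the lines spanned by two nonzero vectors of `ℂ²`. -/
def lineAngle (v w : EuclideanSpace ℂ (Fin 2)) : ℝ :=
  Real.arccos (‖inner ℂ v w‖ / (‖v‖ * ‖w‖))

/-- The chordal distance between the lines spanned by two nonzero vectors of `ℂ²`. -/
def chordalDist (v w : EuclideanSpace ℂ (Fin 2)) : ℝ :=
  Real.sin (lineAngle v w)

/-- All quotients `χ(v, v') / ε`, where `v'` is an eigenvalue of a perturbed polynomial `P + ΔP`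
with `‖ΔB_i‖₂ ≤ ε ω_i` for all `i`, lying in the `δ`-neighbourhood of the eigenvalue `v`. -/
def chordalQuotients {n k : ℕ} (B : Coeffs n k) (ω : Fin (k + 1) → ℝ)
    (v : EuclideanSpace ℂ (Fin 2)) (δ ε : ℝ) : Set ℝ :=
  {r | ∃ (ΔB : Coeffs n k) (v' : EuclideanSpace ℂ (Fin 2)),
      (∀ i, ‖ΔB i‖ ≤ ε * ω i) ∧ IsEigenvalue (B + ΔB) v' ∧ chordalDist v v' < δ ∧
        r = chordalDist v v' / ε}

/-- `κ` is the Stewart–Sun condition number of the eigenvalue `v` of `P`: the limit, as `ε → 0⁺`, of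
the supremum of `χ(v, v') / ε` over the perturbations with `‖ΔB_i‖₂ ≤ ε ω_i`. The perturbed
eigenvalue `v'` is the one that approaches `v`, not one of the other eigenvalues of `P + ΔP`: it is
selected by restricting to a fixed `δ`-neighbourhood of `v`, the limit being the same for all
sufficiently small `δ > 0`. (The sets of quotients contain `0` and are bounded by `1 / ε`.) -/
def IsStewartSunCond {n k : ℕ} (B : Coeffs n k) (ω : Fin (k + 1) → ℝ)
    (v : EuclideanSpace ℂ (Fin 2)) (κ : ℝ) : Prop :=
  ∀ᶠ δ in 𝓝[>] (0 : ℝ),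
    Filter.Tendsto (fun ε : ℝ => sSup (chordalQuotients B ω v δ ε)) (𝓝[>] (0 : ℝ)) (𝓝 κ)

/-- `K` is the condition operator of the eigenvalue `v` of `P`: the differential at the coefficient
tuple `B` of a map `G` that sends each nearby tuple to an eigenvalue and `B` to `v` (the implicit
function for the eigenvalue). A line near that of `v` is given by its representative in
`v + v^⊥`, and the tangent space of the projective line at `v` is thereby identified with
`v^⊥`. -/
def IsConditionOperator {n k : ℕ} (B : Coeffs n k) (v : EuclideanSpace ℂ (Fin 2))
    (K : Coeffs n k →L[ℂ] EuclideanSpace ℂ (Fin 2)) : Prop :=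
  ∃ G : Coeffs n k → EuclideanSpace ℂ (Fin 2),
    G B = v ∧ (∀ᶠ B' in 𝓝 B, IsEigenvalue B' (G B') ∧ inner ℂ v (G B' - v) = 0) ∧
      HasFDerivAt G K B

/-- The unit ball of the weighted norm `(∑ i, (‖ΔB_i‖₂ / ω_i)²)^(1/2)` on coefficient tuples, where
a zero weight `ω_i` means that `B_i` is not perturbed. -/
def weightedUnitBall (n : ℕ) {k : ℕ} (ω : Fin (k + 1) → ℝ) : Set (Coeffs n k) :=
  {ΔB | (∀ i, ω i = 0 → ΔB i = 0) ∧ Real.sqrt (∑ i, (‖ΔB i‖ / ω i) ^ 2) ≤ 1}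

/-- `κ` is the Dedieu–Tisseur condition number of the eigenvalue `v` of `P`: the norm of the
condition operator, with respect to the weighted norm on the coefficient tuples and the norm
`‖·‖₂ / ‖v‖₂` of the tangent space `v^⊥` of the projective line at `v`. -/
def IsDedieuTisseurCond {n k : ℕ} (B : Coeffs n k) (ω : Fin (k + 1) → ℝ)
    (v : EuclideanSpace ℂ (Fin 2)) (κ : ℝ) : Prop :=
  ∃ K : Coeffs n k →L[ℂ] EuclideanSpace ℂ (Fin 2), IsConditionOperator B v K ∧
    IsLUB ((fun ΔB => ‖K ΔB‖ / ‖v‖) '' weightedUnitBall n ω) κ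

end HomMatPoly

end

/-! Lines near that of `v` are written `v + t v^⊥`, with `v^⊥` of the same norm as `v`, and the
eigenvalue becomes a zero `t` of `f(B', t) = det P'(v + t v^⊥)`. Simplicity of the eigenvalue means
exactly `a = ∂f/∂t (B, 0) ≠ 0`, so by the implicit function theorem a perturbation `E` moves the
zero to `t = -a⁻¹ L(E) + o(‖E‖)`, where `L` is the differential of `det` at `P(v)` applied to the
value of `E` at `v`.

Put `m_i = |α₀|^i |β₀|^(k-i)` and let `N` be the norm of that differential. Then `|L(E)| ≤ N ∑ m_i
‖E_i‖`, and for prescribed sizes equality is reached by aligning all `E_i` with one extremal matrix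
(`exists_detDeriv_eq`). Both condition numbers maximize this same sum. Over the box `‖E_i‖ ≤ ω_i`
the maximum gives `κ_θ = (N/|a|) ∑ m_i ω_i`; over the weighted Euclidean ball, Cauchy–Schwarz gives
`κ_h = (N/|a|) (∑ (m_i ω_i)²)^(1/2)`. The factor `N/|a|` cancels in the quotient, so it is never
computed.

For `κ_θ` the first-order formula must hold uniformly over all perturbations of size `ε` and all
eigenvalues within a fixed `δ`; this is the role of `exists_norm_zero_le` and
`eventually_norm_linearization_le`. -/

open Filter

noncomputable section

/-! ### Linear factors of binary forms -/

namespace MvPolynomial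

/-- Homogeneity, as a scaling law for evaluations in an arbitrary commutative algebra. -/
theorem IsHomogeneous.aeval_mul {σ R A : Type*} [CommSemiring R] [CommSemiring A] [Algebra R A]
    {q : MvPolynomial σ R} {m : ℕ} (hq : q.IsHomogeneous m) (c : A) (g : σ → A) :
    MvPolynomial.aeval (fun i => c * g i) q = c ^ m * MvPolynomial.aeval g q := by
  rw [aeval_def, aeval_def, eval₂_eq, eval₂_eq, Finset.mul_sum]
  refine Finset.sum_congr rfl fun d hd => ?_
  have h : ∑ i ∈ d.support, d i = m := by
    have := hq.degree_eq_sum_deg_support hd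
    simpa [Finsupp.degree] using this.symm
  simp only [mul_pow, Finset.prod_mul_distrib, Finset.prod_pow_eq_pow_sum, h]
  ring

/-- The linear form on the plane that vanishes on the line spanned by `v`. -/
def lineForm {K : Type*} [CommRing K] (v : Fin 2 → K) : MvPolynomial (Fin 2) K :=
  C (v 1) * X 0 - C (v 0) * X 1

theorem lineForm_isHomogeneous {K : Type*} [CommRing K] (v : Fin 2 → K) :
    (lineForm v).IsHomogeneous 1 :=
  (isHomogeneous_C_mul_X _ _).sub (isHomogeneous_C_mul_X _ _)

/-- A binary form that vanishes at `v` is divisible by the linear form of the line of `v`. -/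
theorem lineForm_dvd_of_eval_eq_zero {K : Type*} [Field K] {v : Fin 2 → K} (hv : v ≠ 0)
    {q : MvPolynomial (Fin 2) K} {m : ℕ} (hq : q.IsHomogeneous m) (h : eval v q = 0) :
    lineForm v ∣ q := by
  obtain ⟨j, hj⟩ := Function.ne_iff.1 hv
  rw [← Ideal.mem_span_singleton, ← Ideal.Quotient.eq_zero_iff_mem]
  set I := Ideal.span {lineForm v}
  let mk := Ideal.Quotient.mkₐ K I
  -- Modulo the linear form, `(X 0, X 1)` is proportional to `v`. Homogeneity then gives `v_j ^ m q
  -- = X_j ^ m q(v) = 0` in the quotient, where `v_j` is a unit.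
  have hmk : ∀ i, mk (C (v j)) * mk (X i) = mk (X j) * algebraMap K _ (v i) := by
    intro i
    have h0 : mk (lineForm v) = 0 :=
      Ideal.Quotient.eq_zero_iff_mem.2 (Ideal.mem_span_singleton_self _)
    have h1 : mk (C (v 1)) * mk (X 0) = mk (C (v 0)) * mk (X 1) := by
      rw [← map_mul, ← map_mul, ← sub_eq_zero, ← map_sub]; exact h0
    have h2 : algebraMap K (MvPolynomial (Fin 2) K ⧸ I) (v i) = mk (C (v i)) := rfl
    rw [h2]
    fin_cases i <;> fin_cases j <;> first | exact mul_comm _ _ | skip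
    · exact h1.trans (mul_comm _ _)
    · exact h1.symm.trans (mul_comm _ _)
  have h1 : mk q = aeval (fun i => mk (X i)) q := by
    rw [← MvPolynomial.comp_aeval_apply, aeval_X_left_apply]
  have h2 : mk (C (v j)) ^ m * mk q = 0 := by
    rw [h1, ← hq.aeval_mul, _root_.funext hmk, hq.aeval_mul]
    have h3 := MvPolynomial.aeval_algebraMap_apply (A := K) (MvPolynomial (Fin 2) K ⧸ I) v q
    rw [aeval_eq_eval, h, map_zero] at h3
    exact mul_eq_zero_of_right _ h3
  have hu : IsUnit (mk (C (v j))) := ((isUnit_iff_ne_zero.2 hj).map C).map mk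
  exact (hu.pow m).mul_right_eq_zero.1 h2

attribute [local instance] MvPolynomial.gradedAlgebra in
/-- The cofactor of a simple linear factor of a binary form does not vanish on the line. -/
theorem exists_eq_lineForm_mul {K : Type*} [Field K] {v : Fin 2 → K} (hv : v ≠ 0)
    {p : MvPolynomial (Fin 2) K} {d : ℕ} (hp : p.IsHomogeneous d)
    (h : emultiplicity (lineForm v) p = 1) :
    ∃ q, p = lineForm v * q ∧ eval v q ≠ 0 := by
  have h' : emultiplicity (lineForm v) p = (1 : ℕ) := h
  obtain ⟨⟨q, hq⟩, h2⟩ := emultiplicity_eq_coe.1 h'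
  rw [pow_one] at hq
  have hl : lineForm v ∈ homogeneousSubmodule (Fin 2) K 1 := lineForm_isHomogeneous v
  -- The given cofactor is not known to be homogeneous; its component of degree `d - 1` is a
  -- cofactor as well. A zero of that component at `v` would make the square of the linear form
  -- divide `p`.
  have hp' : (DirectSum.decompose (homogeneousSubmodule (Fin 2) K) p d : MvPolynomial _ K) = p :=
    DirectSum.decompose_of_mem_same _ hp
  rw [hq, DirectSum.coe_decompose_mul_of_left_mem _ d hl, ← hq] at hp'
  split_ifs at hp' with hd
  · refine ⟨_, hp'.symm, fun h0 => h2 ?_⟩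
    obtain ⟨r, hr⟩ := lineForm_dvd_of_eval_eq_zero hv
      (SetLike.coe_mem (DirectSum.decompose (homogeneousSubmodule (Fin 2) K) q (d - 1))) h0
    exact ⟨r, by rw [← hp', hr]; ring⟩
  · exact absurd (hp' ▸ dvd_zero _) h2

end MvPolynomial

namespace HomMatPoly

/-! ### The determinant as a binary form -/

open MvPolynomial in
theorem detForm_isHomogeneous {n k : ℕ} (B : Coeffs n k) : (detForm B).IsHomogeneous (n * k) := by
  rw [detForm, Matrix.det_apply']
  refine IsHomogeneous.sum _ _ _ fun σ _ => ?_
  rw [← zero_add (n * k)]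
  refine IsHomogeneous.mul ?_ ?_
  · have : ((Equiv.Perm.sign σ : ℤ) : MvPolynomial (Fin 2) ℂ) = C ((Equiv.Perm.sign σ : ℤ) : ℂ) := by
      simp
    rw [this]
    exact isHomogeneous_C _ _
  · have : n * k = ∑ _i : Fin n, k := by simp
    rw [this]
    refine IsHomogeneous.prod _ _ _ fun i _ => ?_
    rw [Matrix.sum_apply]
    refine IsHomogeneous.sum _ _ _ fun j _ => ?_
    rw [Matrix.smul_apply, Matrix.map_apply, smul_eq_mul, mul_comm]
    refine IsHomogeneous.C_mul ?_ _
    have hj : k = j + (k - j) := by omega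
    conv_rhs => rw [hj]
    exact (isHomogeneous_X_pow _ _).mul (isHomogeneous_X_pow _ _)

theorem eval_detForm {n k : ℕ} (B : Coeffs n k) (u : EuclideanSpace ℂ (Fin 2)) :
    MvPolynomial.eval (u : Fin 2 → ℂ) (detForm B) = (value B u).det := by
  rw [detForm, RingHom.map_det]
  congr 1
  ext i j
  simp [value, Matrix.sum_apply]

theorem isEigenvalue_iff {n k : ℕ} (B : Coeffs n k) (u : EuclideanSpace ℂ (Fin 2)) :
    IsEigenvalue B u ↔ u ≠ 0 ∧ (value B u).det = 0 := by
  rw [IsEigenvalue, Matrix.exists_mulVec_eq_zero_iff.symm]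

theorem value_smul {n k : ℕ} (B : Coeffs n k) (c : ℂ) (u : EuclideanSpace ℂ (Fin 2)) :
    value B (c • u) = c ^ k • value B u := by
  rw [value, value, Finset.smul_sum]
  refine Finset.sum_congr rfl fun i _ => ?_
  have hi : c ^ k = c ^ (i : ℕ) * c ^ (k - (i : ℕ)) := by rw [← pow_add]; congr 1; omega
  rw [smul_smul, hi]
  congr 1
  simp only [PiLp.smul_apply, smul_eq_mul, mul_pow]
  ring

theorem isEigenvalue_smul_iff {n k : ℕ} (B : Coeffs n k) {c : ℂ} (hc : c ≠ 0)
    (u : EuclideanSpace ℂ (Fin 2)) : IsEigenvalue B (c • u) ↔ IsEigenvalue B u := by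
  rw [isEigenvalue_iff, isEigenvalue_iff, value_smul, Matrix.det_smul]
  simp [hc]

/-! ### The affine chart at `v` and the chordal distance -/

/-- The vector of the same norm as `v` that spans the orthogonal complement of `v` in `ℂ²`. -/
def perp (v : EuclideanSpace ℂ (Fin 2)) : EuclideanSpace ℂ (Fin 2) :=
  !₂[-(starRingEnd ℂ (v 1)), starRingEnd ℂ (v 0)]

theorem norm_perp (v : EuclideanSpace ℂ (Fin 2)) : ‖perp v‖ = ‖v‖ := by
  simp [EuclideanSpace.norm_eq, perp, add_comm]

theorem inner_perp (v : EuclideanSpace ℂ (Fin 2)) : inner ℂ v (perp v) = 0 := by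
  simp [PiLp.inner_apply, perp]; ring

theorem ofReal_norm_sq_eq (v : EuclideanSpace ℂ (Fin 2)) :
    ((‖v‖ : ℂ) ^ 2) = v 0 * starRingEnd ℂ (v 0) + v 1 * starRingEnd ℂ (v 1) := by
  rw [Complex.mul_conj', Complex.mul_conj']
  have := EuclideanSpace.norm_sq_eq v
  rw [Fin.sum_univ_two] at this
  rw [← Complex.ofReal_pow, this]; push_cast; rfl

theorem norm_sq_smul_eq (v u : EuclideanSpace ℂ (Fin 2)) :
    ((‖v‖ : ℂ) ^ 2) • u = inner ℂ v u • v + inner ℂ (perp v) u • perp v := by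
  rw [ofReal_norm_sq_eq]
  ext i
  fin_cases i <;> simp [PiLp.inner_apply, perp] <;> ring

theorem eq_smul_perp_of_inner_eq_zero {v u : EuclideanSpace ℂ (Fin 2)} (hv : v ≠ 0)
    (h : inner ℂ v u = 0) : u = (inner ℂ (perp v) u / (‖v‖ : ℂ) ^ 2) • perp v := by
  have hn : ((‖v‖ : ℂ) ^ 2) ≠ 0 := by simpa using hv
  have := norm_sq_smul_eq v u
  rw [h, zero_smul, zero_add] at this
  rw [div_eq_inv_mul, mul_smul, ← this, smul_smul, inv_mul_cancel₀ hn, one_smul]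

theorem norm_add_smul_perp (v : EuclideanSpace ℂ (Fin 2)) (t : ℂ) :
    ‖v + t • perp v‖ = ‖v‖ * Real.sqrt (1 + ‖t‖ ^ 2) := by
  have h : ‖v + t • perp v‖ ^ 2 = ‖v‖ ^ 2 * (1 + ‖t‖ ^ 2) := by
    have := norm_add_sq_eq_norm_sq_add_norm_sq_of_inner_eq_zero (𝕜 := ℂ) v (t • perp v)
      (by rw [inner_smul_right, inner_perp, mul_zero])
    rw [sq, this, norm_smul, norm_perp]; ring
  rw [← Real.sqrt_sq (norm_nonneg (v + _)), h, Real.sqrt_mul (sq_nonneg _),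
    Real.sqrt_sq (norm_nonneg _)]

theorem add_smul_perp_ne_zero {v : EuclideanSpace ℂ (Fin 2)} (hv : v ≠ 0) (t : ℂ) :
    v + t • perp v ≠ 0 := by
  rw [← norm_pos_iff, norm_add_smul_perp]
  have := norm_pos_iff.2 hv
  positivity

/-- Since `perp v` is orthogonal to `v` and of the same norm, `‖t‖` is the tangent of the angle
between the lines, and the chordal distance is its sine. -/
theorem chordalDist_smul_add_smul_perp {v : EuclideanSpace ℂ (Fin 2)} (hv : v ≠ 0) {c : ℂ}
    (hc : c ≠ 0) (t : ℂ) :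
    chordalDist v (c • (v + t • perp v)) = ‖t‖ / Real.sqrt (1 + ‖t‖ ^ 2) := by
  have hv' := norm_pos_iff.2 hv
  have hc' := norm_pos_iff.2 hc
  have hs : 0 < 1 + ‖t‖ ^ 2 := by positivity
  rw [chordalDist, lineAngle, Real.sin_arccos, inner_smul_right, inner_add_right, inner_smul_right,
    inner_perp, mul_zero, add_zero, norm_mul, norm_smul, norm_add_smul_perp]
  have h1 : ‖inner ℂ v v‖ = ‖v‖ ^ 2 := by
    rw [inner_self_eq_norm_sq_to_K]; simp
  have h2 : ‖c‖ * ‖inner ℂ v v‖ / (‖v‖ * (‖c‖ * (‖v‖ * Real.sqrt (1 + ‖t‖ ^ 2))))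
      = 1 / Real.sqrt (1 + ‖t‖ ^ 2) := by
    rw [h1]; field_simp
  rw [h2, div_pow, Real.sq_sqrt hs.le, ← Real.sqrt_sq (norm_nonneg t), ← Real.sqrt_div (sq_nonneg _),
    Real.sqrt_sq (norm_nonneg t)]
  congr 1
  field_simp
  ring

/-- The chart misses only the line orthogonal to `v`, which is at chordal distance 1. -/
theorem exists_eq_smul_add_smul_perp {v u : EuclideanSpace ℂ (Fin 2)} (hv : v ≠ 0)
    (h : chordalDist v u < 1) : ∃ c t : ℂ, c ≠ 0 ∧ u = c • (v + t • perp v) := by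
  have hn : ((‖v‖ : ℂ) ^ 2) ≠ 0 := by simpa using hv
  have hi : inner ℂ v u ≠ 0 := by
    intro h0
    simp [chordalDist, lineAngle, h0] at h
  refine ⟨inner ℂ v u / (‖v‖ : ℂ) ^ 2, inner ℂ (perp v) u / inner ℂ v u, div_ne_zero hi hn, ?_⟩
  have := norm_sq_smul_eq v u
  rw [smul_add, smul_smul, div_mul_div_comm, mul_comm (inner ℂ v u), mul_div_mul_right _ _ hi,
    div_eq_inv_mul, div_eq_inv_mul, mul_smul, mul_smul, ← smul_add, ← this, smul_smul,
    inv_mul_cancel₀ hn, one_smul]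

end HomMatPoly

/-! ### Nondegenerate zeros: implicit function and linearization -/

/-- A scalar implicit function, with its derivative. -/
theorem exists_implicit_of_hasStrictFDerivAt {E : Type*} [NormedAddCommGroup E] [NormedSpace ℂ E]
    [CompleteSpace E] {f : E × ℂ → ℂ} {x : E} {l : E →L[ℂ] ℂ} {a : ℂ}
    (hf : HasStrictFDerivAt f (l.coprod (ContinuousLinearMap.toSpanSingleton ℂ a)) (x, 0))
    (ha : a ≠ 0) (h0 : f (x, 0) = 0) :
    ∃ τ : E → ℂ, τ x = 0 ∧ (∀ᶠ y in 𝓝 x, f (y, τ y) = 0) ∧ HasFDerivAt τ (-a⁻¹ • l) x := by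
  have hr : (l.coprod (ContinuousLinearMap.toSpanSingleton ℂ a)) ∘L .inr ℂ E ℂ =
      (ContinuousLinearEquiv.unitsEquivAut ℂ (Units.mk0 a ha) : ℂ →L[ℂ] ℂ) := by
    ext; simp
  have hi : ((l.coprod (ContinuousLinearMap.toSpanSingleton ℂ a)) ∘L
      .inr ℂ E ℂ).IsInvertible := ⟨_, hr.symm⟩
  refine ⟨hf.implicitFunctionOfProdDomain hi, ?_, ?_, ?_⟩
  · exact (hf.eventually_apply_eq_iff_implicitFunctionOfProdDomain hi).self_of_nhds.1 rfl
  · simpa [h0] using hf.eventually_apply_implicitFunctionOfProdDomain hi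
  · refine (hf.hasStrictFDerivAt_implicitFunctionOfProdDomain hi).hasFDerivAt.congr_fderiv ?_
    rw [hr, ContinuousLinearMap.inverse_equiv]
    ext y
    simp [mul_comm]

/-- Zeros of a differentiable function near a nondegenerate zero obey the linearized equation up to
a small relative error. -/
theorem eventually_norm_linearization_le {E : Type*} [NormedAddCommGroup E] [NormedSpace ℂ E]
    {f : E × ℂ → ℂ} {x : E} {l : E →L[ℂ] ℂ} {a : ℂ}
    (hf : HasFDerivAt f (l.coprod (ContinuousLinearMap.toSpanSingleton ℂ a)) (x, 0))
    (h0 : f (x, 0) = 0) {η : ℝ} (hη : 0 < η) :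
    ∃ ρ > 0, ∀ (e : E) (t : ℂ), ‖e‖ < ρ → ‖t‖ < ρ → f (x + e, t) = 0 →
      ‖a‖ * ‖t‖ ≤ ‖l e‖ + η * (‖e‖ + ‖t‖) := by
  have h := (hasFDerivAt_iff_isLittleO_nhds_zero.1 hf).def hη
  obtain ⟨ρ, hρ, H⟩ := Metric.eventually_nhds_iff.1 h
  refine ⟨ρ, hρ, fun e t he ht hz => ?_⟩
  have h1 := @H (e, t) (by
    rw [dist_zero_right, Prod.norm_mk]; exact max_lt he ht)
  simp only [Prod.mk_add_mk, zero_add, hz, h0, sub_zero, zero_sub, norm_neg,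
    ContinuousLinearMap.coprod_apply, ContinuousLinearMap.toSpanSingleton_apply, Prod.norm_mk,
    smul_eq_mul] at h1
  have h2 : max ‖e‖ ‖t‖ ≤ ‖e‖ + ‖t‖ :=
    max_le (by linarith [norm_nonneg t]) (by linarith [norm_nonneg e])
  have h3 : ‖a‖ * ‖t‖ ≤ ‖l e + t * a‖ + ‖l e‖ := by
    calc ‖a‖ * ‖t‖ = ‖(l e + t * a) - l e‖ := by rw [add_sub_cancel_left, norm_mul, mul_comm]
      _ ≤ _ := norm_sub_le _ _
  nlinarith

/-- Zeros near a nondegenerate zero depend on the parameter in a Lipschitz way. -/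
theorem exists_norm_zero_le {E : Type*} [NormedAddCommGroup E] [NormedSpace ℂ E]
    {f : E × ℂ → ℂ} {x : E} {l : E →L[ℂ] ℂ} {a : ℂ}
    (hf : HasFDerivAt f (l.coprod (ContinuousLinearMap.toSpanSingleton ℂ a)) (x, 0))
    (ha : a ≠ 0) (h0 : f (x, 0) = 0) :
    ∃ ρ > 0, ∃ C ≥ 0, ∀ (e : E) (t : ℂ), ‖e‖ < ρ → ‖t‖ < ρ → f (x + e, t) = 0 →
      ‖t‖ ≤ C * ‖e‖ := by
  have ha' := norm_pos_iff.2 ha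
  obtain ⟨ρ, hρ, H⟩ := eventually_norm_linearization_le hf h0 (half_pos ha')
  -- With `η = ‖a‖ / 2` the term `η ‖t‖` is absorbed into half of `‖a‖ ‖t‖`.
  refine ⟨ρ, hρ, 2 / ‖a‖ * (‖l‖ + ‖a‖ / 2), by positivity, fun e t he ht hz => ?_⟩
  have h1 := H e t he ht hz
  have h2 := l.le_opNorm e
  rw [mul_assoc, div_mul_eq_mul_div, le_div_iff₀ ha']
  nlinarith

/-- A functional on a finite-dimensional space attains its norm on the closed unit ball. -/
theorem ContinuousLinearMap.exists_apply_eq_norm {V : Type*} [NormedAddCommGroup V]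
    [NormedSpace ℂ V] [FiniteDimensional ℂ V] (L : V →L[ℂ] ℂ) :
    ∃ F, ‖F‖ ≤ 1 ∧ L F = (‖L‖ : ℂ) := by
  have := FiniteDimensional.proper ℂ V
  obtain ⟨F, hF, h⟩ := (isCompact_closedBall (0 : V) 1).exists_sSup_image_eq
    ⟨0, Metric.mem_closedBall_self zero_le_one⟩ (L.continuous.norm.continuousOn)
  rw [L.sSup_unitClosedBall_eq_norm] at h
  -- The phase makes `L F` real and nonnegative. If `L F = 0`, then `‖L‖ = 0` and the witness is
  -- zero.
  refine ⟨(starRingEnd ℂ (L F) / ‖L F‖) • F, ?_, ?_⟩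
  · rw [norm_smul]
    refine mul_le_one₀ ?_ (norm_nonneg _) (by simpa using hF)
    rw [norm_div, RCLike.norm_conj, Complex.norm_real, norm_norm]
    exact div_self_le_one _
  · rw [map_smul, smul_eq_mul, div_mul_eq_mul_div, Complex.conj_mul', h, sq, mul_self_div_self]

namespace HomMatPoly

/-! ### The determinant in the chart and its derivative -/

theorem contDiff_det {n : ℕ} :
    ContDiff ℂ 1 (fun A : Matrix (Fin n) (Fin n) ℂ => A.det) := by
  simp only [Matrix.det_apply']
  refine ContDiff.sum fun σ _ => contDiff_const.mul (contDiff_prod fun i _ => ?_)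
  exact (LinearMap.toContinuousLinearMap
    (Matrix.entryLinearMap ℂ ℂ (σ i) i)).contDiff

/-- The value at a fixed vector, as a continuous linear function of the coefficients. -/
def valueCLM (n k : ℕ) (v : EuclideanSpace ℂ (Fin 2)) :
    Coeffs n k →L[ℂ] Matrix (Fin n) (Fin n) ℂ :=
  ∑ i : Fin (k + 1), (v 0 ^ (i : ℕ) * v 1 ^ (k - (i : ℕ))) • ContinuousLinearMap.proj i

theorem valueCLM_apply {n k : ℕ} (v : EuclideanSpace ℂ (Fin 2)) (B : Coeffs n k) :
    valueCLM n k v B = value B v := by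
  simp [valueCLM, value]

/-- The determinant of `P` in the affine chart `v + t v^⊥` of the projective line. -/
def chartDet {n k : ℕ} (v : EuclideanSpace ℂ (Fin 2)) (p : Coeffs n k × ℂ) : ℂ :=
  (value p.1 (v + p.2 • perp v)).det

theorem isEigenvalue_add_smul_perp_iff {n k : ℕ} (B : Coeffs n k) {v : EuclideanSpace ℂ (Fin 2)}
    (hv : v ≠ 0) (t : ℂ) : IsEigenvalue B (v + t • perp v) ↔ chartDet v (B, t) = 0 := by
  rw [isEigenvalue_iff]
  exact and_iff_right (add_smul_perp_ne_zero hv t)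

theorem contDiff_chartDet {n k : ℕ} (v : EuclideanSpace ℂ (Fin 2)) :
    ContDiff ℂ 1 (chartDet v : Coeffs n k × ℂ → ℂ) := by
  refine contDiff_det.comp ?_
  simp only [value]
  refine ContDiff.sum fun i _ => ContDiff.fun_smul ?_ ?_
  · simp only [PiLp.add_apply, PiLp.smul_apply, smul_eq_mul]
    fun_prop
  · exact ((ContinuousLinearMap.proj (R := ℂ) (φ := fun _ => Matrix (Fin n) (Fin n) ℂ) i).comp
      (ContinuousLinearMap.fst ℂ (Coeffs n k) ℂ)).contDiff

/-- The first-order change of the determinant at `v` under a perturbation of the coefficients. -/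
def detDeriv {n k : ℕ} (B : Coeffs n k) (v : EuclideanSpace ℂ (Fin 2)) : Coeffs n k →L[ℂ] ℂ :=
  (fderiv ℂ (fun A : Matrix (Fin n) (Fin n) ℂ => A.det) (value B v)).comp (valueCLM n k v)

/-- On the chart the linear form of `v` equals `-t ‖v‖²`, so the determinant is `t` times a function
that is nonzero at `t = 0` because the factor is simple. -/
theorem IsSimpleEigenvalue.exists_hasDerivAt {n k : ℕ} {B : Coeffs n k}
    {v : EuclideanSpace ℂ (Fin 2)} (hv : IsSimpleEigenvalue B v) :
    ∃ a ≠ 0, HasDerivAt (fun t => chartDet v (B, t)) a 0 ∧ chartDet v (B, 0) = 0 := by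
  have hv0 : (v : Fin 2 → ℂ) ≠ 0 := fun h => hv.1 (by ext i; exact congrFun h i)
  obtain ⟨q, hq, hqv⟩ := MvPolynomial.exists_eq_lineForm_mul hv0 (detForm_isHomogeneous B) hv.2
  have hn : ((‖v‖ : ℂ) ^ 2) ≠ 0 := by simpa using hv.1
  have key : ∀ t : ℂ, chartDet v (B, t) =
      t * (-(‖v‖ : ℂ) ^ 2 * MvPolynomial.eval (v + t • perp v : EuclideanSpace ℂ (Fin 2)) q) := by
    intro t
    rw [chartDet, ← eval_detForm, hq, map_mul, ofReal_norm_sq_eq]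
    have h0 : (v + t • perp v) 0 = v 0 - t * starRingEnd ℂ (v 1) := by
      simp [perp, sub_eq_add_neg]
    have h1 : (v + t • perp v) 1 = v 1 + t * starRingEnd ℂ (v 0) := by
      simp [perp]
    simp only [MvPolynomial.lineForm, map_sub, map_mul, MvPolynomial.eval_C, MvPolynomial.eval_X,
      h0, h1]
    ring
  refine ⟨-(‖v‖ : ℂ) ^ 2 * MvPolynomial.eval v q, mul_ne_zero (neg_ne_zero.2 hn) hqv, ?_, ?_⟩
  · rw [hasDerivAt_iff_tendsto_slope_zero]
    have hc : Continuous fun t : ℂ =>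
        -(‖v‖ : ℂ) ^ 2 * MvPolynomial.eval (v + t • perp v : EuclideanSpace ℂ (Fin 2)) q := by
      refine continuous_const.mul ((MvPolynomial.continuous_eval q).comp ?_)
      fun_prop
    have ht := (hc.tendsto 0).mono_left (nhdsWithin_le_nhds (s := {0}ᶜ))
    rw [zero_smul, add_zero] at ht
    refine ht.congr' ?_
    filter_upwards [self_mem_nhdsWithin] with t ht0
    rw [zero_add, key t, key 0, zero_mul, sub_zero, smul_eq_mul, inv_mul_cancel_left₀ ht0]
  · rw [key, zero_mul]

/-- Strict differentiability comes from `C¹`; the differential on the product is determined by its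
two partial derivatives. -/
theorem hasStrictFDerivAt_chartDet {n k : ℕ} {B : Coeffs n k} {v : EuclideanSpace ℂ (Fin 2)}
    {a : ℂ} (ha : HasDerivAt (fun t => chartDet v (B, t)) a 0) :
    HasStrictFDerivAt (chartDet v)
      ((detDeriv B v).coprod (ContinuousLinearMap.toSpanSingleton ℂ a)) (B, 0) := by
  have h := (contDiff_chartDet (n := n) (k := k) v).contDiffAt.hasStrictFDerivAt
    (x := (B, 0)) one_ne_zero
  have h2 : (fun B' : Coeffs n k => chartDet v (B', 0)) =
      (fun A : Matrix (Fin n) (Fin n) ℂ => A.det) ∘ (valueCLM n k v) := by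
    ext B'
    simp [chartDet, valueCLM_apply]
  have hl : HasFDerivAt (fun E : Coeffs n k => (E, (0 : ℂ))) (.inl ℂ (Coeffs n k) ℂ) B :=
    hasFDerivAt_prodMk_left B (0 : ℂ)
  have hr : HasFDerivAt (fun t : ℂ => (B, t)) (.inr ℂ (Coeffs n k) ℂ) 0 :=
    hasFDerivAt_prodMk_right B (0 : ℂ)
  have h1 := HasFDerivAt.comp (g := chartDet v) (f := fun E => (E, 0)) B h.hasFDerivAt hl
  have h3 := ((contDiff_det (n := n)).differentiable one_ne_zero
    (valueCLM n k v B)).hasFDerivAt.comp B (valueCLM n k v).hasFDerivAt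
  have h4 := h1.unique (h2 ▸ h3)
  have h5 := ha.hasFDerivAt.unique
    (HasFDerivAt.comp (g := chartDet v) (f := fun t => (B, t)) (0 : ℂ) h.hasFDerivAt hr)
  rw [valueCLM_apply] at h4
  refine h.congr_fderiv ?_
  ext1
  · rw [h4, ContinuousLinearMap.coprod_comp_inl, detDeriv]
  · rw [← h5, ContinuousLinearMap.coprod_comp_inr]

/-! ### The size of the first-order change -/

/-- The modulus `|α₀| ^ i |β₀| ^ (k - i)` of the factor of the coefficient `B_i` at `v`. -/
def monomialNorm (k : ℕ) (v : EuclideanSpace ℂ (Fin 2)) (i : Fin (k + 1)) : ℝ :=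
  ‖v 0‖ ^ (i : ℕ) * ‖v 1‖ ^ (k - (i : ℕ))

theorem norm_monomial (k : ℕ) (v : EuclideanSpace ℂ (Fin 2)) (i : Fin (k + 1)) :
    ‖v 0 ^ (i : ℕ) * v 1 ^ (k - (i : ℕ))‖ = monomialNorm k v i := by
  simp [monomialNorm]

theorem monomialNorm_nonneg (k : ℕ) (v : EuclideanSpace ℂ (Fin 2)) (i : Fin (k + 1)) :
    0 ≤ monomialNorm k v i := by
  rw [monomialNorm]; positivity

/-- The norm of the differential of the determinant at the value `P(α₀, β₀)`. -/
def detNorm {n k : ℕ} (B : Coeffs n k) (v : EuclideanSpace ℂ (Fin 2)) : ℝ :=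
  ‖fderiv ℂ (fun A : Matrix (Fin n) (Fin n) ℂ => A.det) (value B v)‖

theorem norm_detDeriv_le {n k : ℕ} (B : Coeffs n k) (v : EuclideanSpace ℂ (Fin 2))
    (E : Coeffs n k) :
    ‖detDeriv B v E‖ ≤ detNorm B v * ∑ i, monomialNorm k v i * ‖E i‖ := by
  rw [detDeriv, ContinuousLinearMap.comp_apply, valueCLM_apply, detNorm]
  refine (ContinuousLinearMap.le_opNorm _ _).trans ?_
  refine mul_le_mul_of_nonneg_left ?_ (norm_nonneg _)
  refine (norm_sum_le _ _).trans (Finset.sum_le_sum fun i _ => ?_)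
  rw [norm_smul, norm_monomial]

/-- Along suitable perturbations of prescribed sizes `r i`, the bound `norm_detDeriv_le` is
attained. -/
theorem exists_detDeriv_eq {n k : ℕ} (B : Coeffs n k) (v : EuclideanSpace ℂ (Fin 2))
    (r : Fin (k + 1) → ℝ) (hr : ∀ i, 0 ≤ r i) :
    ∃ E : Coeffs n k, (∀ i, ‖E i‖ ≤ r i) ∧
      ‖detDeriv B v E‖ = detNorm B v * ∑ i, monomialNorm k v i * r i := by
  obtain ⟨F, hF, hL⟩ := (fderiv ℂ (fun A : Matrix (Fin n) (Fin n) ℂ => A.det)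
    (value B v)).exists_apply_eq_norm
  let c : Fin (k + 1) → ℂ := fun i => v 0 ^ (i : ℕ) * v 1 ^ (k - (i : ℕ))
  -- The phases cancel those of the monomials `c i`, so that every term of the value is a
  -- nonnegative multiple of the same `F`. Where `c i = 0` the matrix is zero and its term
  -- contributes nothing anyway.
  refine ⟨fun i => (starRingEnd ℂ (c i) / ‖c i‖ * r i) • F, fun i => ?_, ?_⟩
  · rw [norm_smul, norm_mul, norm_div, RCLike.norm_conj, Complex.norm_real, norm_norm,
      Complex.norm_real, Real.norm_of_nonneg (hr i)]
    refine (mul_le_of_le_one_right (by have := hr i; positivity) hF).trans ?_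
    exact mul_le_of_le_one_left (hr i) (div_self_le_one _)
  · have h : value (fun i => (starRingEnd ℂ (c i) / ‖c i‖ * r i) • F : Coeffs n k) v =
        ((∑ i, monomialNorm k v i * r i : ℝ) : ℂ) • F := by
      rw [value, Complex.ofReal_sum, Finset.sum_smul]
      refine Finset.sum_congr rfl fun i _ => ?_
      rw [smul_smul]
      congr 1
      change c i * _ = _
      rw [← mul_assoc, mul_div_assoc', Complex.mul_conj', sq, mul_self_div_self, norm_monomial,
        Complex.ofReal_mul]
    rw [detDeriv, ContinuousLinearMap.comp_apply, valueCLM_apply, h, map_smul, hL, smul_eq_mul,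
      norm_mul, Complex.norm_real, Complex.norm_real, norm_norm, mul_comm, detNorm,
      Real.norm_of_nonneg
        (Finset.sum_nonneg fun i _ => mul_nonneg (monomialNorm_nonneg k v i) (hr i))]

/-! ### The Dedieu–Tisseur condition number -/

/-- Uniqueness needs no uniqueness of `G`: in the chart, any admissible `G` satisfies `chartDet v
(B', σ B') = 0` near `B`, and differentiating this determines `K`. Existence is the implicit
function theorem. -/
theorem isConditionOperator_iff {n k : ℕ} {B : Coeffs n k} {v : EuclideanSpace ℂ (Fin 2)}
    (hv : v ≠ 0) {a : ℂ} (ha : a ≠ 0) (hd : HasDerivAt (fun t => chartDet v (B, t)) a 0)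
    (h0 : chartDet v (B, 0) = 0) (K : Coeffs n k →L[ℂ] EuclideanSpace ℂ (Fin 2)) :
    IsConditionOperator B v K ↔ K = (-a⁻¹ • detDeriv B v).smulRight (perp v) := by
  have hf := hasStrictFDerivAt_chartDet hd
  constructor
  · rintro ⟨G, hG, hE, hK⟩
    have hn : ((‖v‖ : ℂ) ^ 2) ≠ 0 := by simpa using hv
    let ip (u : EuclideanSpace ℂ (Fin 2)) : EuclideanSpace ℂ (Fin 2) →L[ℂ] ℂ := innerSL ℂ u
    have hip : ∀ u, HasFDerivAt (fun B' => ip u (G B' - v)) ((ip u).comp K) B := fun u =>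
      (ip u).hasFDerivAt.comp B (hK.sub_const v)
    have h1 : (ip v).comp K = 0 := by
      refine (hip v).unique ((hasFDerivAt_const (0 : ℂ) B).congr_of_eventuallyEq ?_)
      filter_upwards [hE] with B' hB' using hB'.2
    -- The chart coordinate of `G B'`.
    let σ : Coeffs n k → ℂ := fun B' => ((‖v‖ : ℂ) ^ 2)⁻¹ * ip (perp v) (G B' - v)
    have hσ : HasFDerivAt σ (((‖v‖ : ℂ) ^ 2)⁻¹ • (ip (perp v)).comp K) B :=
      (hip (perp v)).const_mul _
    have hσB : σ B = 0 := by simp [σ, hG]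
    have hz : ∀ᶠ B' in 𝓝 B, chartDet v (B', σ B') = 0 := by
      filter_upwards [hE] with B' hB'
      rw [← isEigenvalue_add_smul_perp_iff B' hv]
      have h2 := eq_smul_perp_of_inner_eq_zero hv hB'.2
      have h3 : G B' = v + σ B' • perp v := by
        rw [div_eq_inv_mul] at h2
        exact sub_eq_iff_eq_add'.1 h2
      exact h3 ▸ hB'.1
    have hc : HasFDerivAt (fun B' => (B', σ B'))
        ((ContinuousLinearMap.id ℂ (Coeffs n k)).prod
          (((‖v‖ : ℂ) ^ 2)⁻¹ • (ip (perp v)).comp K)) B :=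
      (hasFDerivAt_id B).prodMk hσ
    have hf' := hf.hasFDerivAt
    rw [← hσB] at hf'
    have h4 := (HasFDerivAt.comp (g := chartDet v) (f := fun B' => (B', σ B')) B hf' hc).unique
      ((hasFDerivAt_const (0 : ℂ) B).congr_of_eventuallyEq hz)
    ext1 E
    have h5 := congrArg (· E) h1
    have h6 := congrArg (· E) h4
    simp only [ContinuousLinearMap.comp_apply, zero_apply,
      ContinuousLinearMap.prod_apply, ContinuousLinearMap.coprod_apply,
      ContinuousLinearMap.toSpanSingleton_apply, smul_apply,
      ContinuousLinearMap.id_apply, smul_eq_mul, ip, innerSL_apply_apply] at h5 h6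
    rw [eq_smul_perp_of_inner_eq_zero hv h5, ContinuousLinearMap.smulRight_apply,
      smul_apply, smul_eq_mul, div_eq_inv_mul]
    congr 1
    rw [eq_neg_of_add_eq_zero_left h6]
    field_simp
  · rintro rfl
    obtain ⟨τ, hτ, hz, hdτ⟩ := exists_implicit_of_hasStrictFDerivAt hf ha h0
    refine ⟨fun B' => v + τ B' • perp v, by simp [hτ], ?_, ?_⟩
    · filter_upwards [hz] with B' hB'
      refine ⟨(isEigenvalue_add_smul_perp_iff B' hv _).2 hB', ?_⟩
      rw [add_sub_cancel_left, inner_smul_right, inner_perp, mul_zero]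
    · exact (hdτ.smul_const (perp v)).const_add v

theorem isLUB_conditionOperator {n k : ℕ} (B : Coeffs n k) {ω : Fin (k + 1) → ℝ}
    (hω : ∀ i, 0 ≤ ω i) {v : EuclideanSpace ℂ (Fin 2)} (hv : v ≠ 0) (a : ℂ) :
    IsLUB ((fun ΔB => ‖(-a⁻¹ • detDeriv B v).smulRight (perp v) ΔB‖ / ‖v‖) '' weightedUnitBall n ω)
      (Real.sqrt (∑ i, (monomialNorm k v i * ω i) ^ 2) * (detNorm B v / ‖a‖)) := by
  have hK : ∀ E : Coeffs n k, ‖(-a⁻¹ • detDeriv B v).smulRight (perp v) E‖ / ‖v‖ =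
      ‖detDeriv B v E‖ / ‖a‖ := by
    intro E
    rw [ContinuousLinearMap.smulRight_apply, norm_smul, norm_perp,
      mul_div_cancel_right₀ _ (norm_ne_zero_iff.2 hv), smul_apply, norm_smul,
      norm_neg, norm_inv, div_eq_inv_mul]
  simp only [hK]
  set T := Real.sqrt (∑ i, (monomialNorm k v i * ω i) ^ 2) with hT
  have hsum : (0 : ℝ) ≤ ∑ i, (monomialNorm k v i * ω i) ^ 2 :=
    Finset.sum_nonneg fun i _ => sq_nonneg _
  refine IsGreatest.isLUB ⟨?_, ?_⟩
  · obtain ⟨E, hE, hL⟩ := exists_detDeriv_eq B v (fun i => monomialNorm k v i * ω i ^ 2 / T)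
      (fun i => by have := monomialNorm_nonneg k v i; positivity)
    refine ⟨E, ⟨fun i hi => ?_, ?_⟩, ?_⟩
    · have := hE i
      rw [hi] at this
      simpa using this
    · refine (Real.sqrt_le_sqrt ?_).trans_eq Real.sqrt_one
      calc ∑ i, (‖E i‖ / ω i) ^ 2 ≤ ∑ i, (monomialNorm k v i * ω i) ^ 2 / T ^ 2 := by
            refine Finset.sum_le_sum fun i _ => ?_
            rw [← div_pow]
            refine pow_le_pow_left₀ (div_nonneg (norm_nonneg _) (hω i)) ?_ 2
            refine div_le_of_le_mul₀ (hω i) (by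
              have := monomialNorm_nonneg k v i; have := hω i; positivity) ((hE i).trans ?_)
            exact le_of_eq (by ring)
        _ ≤ 1 := by
            rw [← Finset.sum_div, Real.sq_sqrt hsum]
            exact div_self_le_one _
    · have h1 : ∑ i, monomialNorm k v i * (monomialNorm k v i * ω i ^ 2 / T) = T := by
        calc _ = (∑ i, (monomialNorm k v i * ω i) ^ 2) / T := by
              rw [Finset.sum_div]; exact Finset.sum_congr rfl fun i _ => by ring
          _ = T := Real.div_sqrt
      simp only [hL, h1]
      ring
  · rintro _ ⟨E, ⟨h0, h1⟩, rfl⟩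
    simp only
    have h2 : ∑ i, monomialNorm k v i * ‖E i‖ ≤ T := by
      calc ∑ i, monomialNorm k v i * ‖E i‖
          = ∑ i, (monomialNorm k v i * ω i) * (‖E i‖ / ω i) := by
            refine Finset.sum_congr rfl fun i _ => ?_
            by_cases hi : ω i = 0
            · simp [hi, h0 i hi]
            · field_simp
        _ ≤ T * Real.sqrt (∑ i, (‖E i‖ / ω i) ^ 2) := Real.sum_mul_le_sqrt_mul_sqrt _ _ _
        _ ≤ T := mul_le_of_le_one_right (Real.sqrt_nonneg _) h1
    calc ‖detDeriv B v E‖ / ‖a‖ ≤ detNorm B v * T / ‖a‖ := by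
          refine div_le_div_of_nonneg_right ((norm_detDeriv_le B v E).trans ?_) (norm_nonneg _)
          exact mul_le_mul_of_nonneg_left h2 (norm_nonneg _)
      _ = _ := by ring

/-! ### The Stewart–Sun condition number -/

theorem chordalDist_smul_add_smul_perp_le {v : EuclideanSpace ℂ (Fin 2)} (hv : v ≠ 0) {c : ℂ}
    (hc : c ≠ 0) (t : ℂ) : chordalDist v (c • (v + t • perp v)) ≤ ‖t‖ := by
  rw [chordalDist_smul_add_smul_perp hv hc]
  exact div_le_self (norm_nonneg _) (Real.one_le_sqrt.2 (by nlinarith [sq_nonneg ‖t‖]))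

theorem norm_le_two_mul_of_chordalDist_lt {v : EuclideanSpace ℂ (Fin 2)} (hv : v ≠ 0) {c : ℂ}
    (hc : c ≠ 0) {t : ℂ} {δ : ℝ} (hδ : δ ≤ 1 / 2)
    (h : chordalDist v (c • (v + t • perp v)) < δ) : ‖t‖ ≤ 2 * δ := by
  have hs : 0 < 1 + ‖t‖ ^ 2 := by positivity
  rw [chordalDist_smul_add_smul_perp hv hc, div_lt_iff₀ (Real.sqrt_pos.2 hs)] at h
  have hδ0 : 0 < δ := by
    by_contra! hn
    nlinarith [norm_nonneg t, Real.sqrt_nonneg (1 + ‖t‖ ^ 2)]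
  have h2 : ‖t‖ ^ 2 ≤ δ ^ 2 * (1 + ‖t‖ ^ 2) := by
    have := pow_le_pow_left₀ (norm_nonneg t) h.le 2
    rwa [mul_pow, Real.sq_sqrt hs.le] at this
  refine le_of_sq_le_sq ?_ (by positivity)
  nlinarith [sq_nonneg ‖t‖, mul_le_mul hδ hδ hδ0.le (by norm_num)]

theorem chordalDist_le_one (v w : EuclideanSpace ℂ (Fin 2)) : chordalDist v w ≤ 1 :=
  Real.sin_le_one _

theorem bddAbove_chordalQuotients {n k : ℕ} (B : Coeffs n k) (ω : Fin (k + 1) → ℝ)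
    (v : EuclideanSpace ℂ (Fin 2)) (δ : ℝ) {ε : ℝ} (hε : 0 < ε) :
    BddAbove (chordalQuotients B ω v δ ε) := by
  refine ⟨1 / ε, ?_⟩
  rintro _ ⟨ΔB, v', -, -, -, rfl⟩
  exact div_le_div_of_nonneg_right (chordalDist_le_one _ _) hε.le

/-- Asymptotic upper bound: eigenvalues of small perturbations in a fixed small neighbourhood. -/
theorem eventually_sSup_chordalQuotients_lt {n k : ℕ} {B : Coeffs n k} {ω : Fin (k + 1) → ℝ}
    (hω : ∀ i, 0 ≤ ω i) {v : EuclideanSpace ℂ (Fin 2)} (hv : v ≠ 0) {a : ℂ} (ha : a ≠ 0)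
    (hd : HasDerivAt (fun t => chartDet v (B, t)) a 0) (h0 : chartDet v (B, 0) = 0) :
    ∃ δ₀ > 0, ∀ δ < δ₀, ∀ κ, (∑ i, monomialNorm k v i * ω i) * (detNorm B v / ‖a‖) < κ →
      ∀ᶠ ε in 𝓝[>] (0 : ℝ), sSup (chordalQuotients B ω v δ ε) < κ := by
  have hf := (hasStrictFDerivAt_chartDet hd).hasFDerivAt
  have ha' := norm_pos_iff.2 ha
  obtain ⟨ρ, hρ, C, hC, H⟩ := exists_norm_zero_le hf ha h0
  set W := ∑ i, ω i with hW
  set S := ∑ i, monomialNorm k v i * ω i with hS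
  have hW0 : 0 ≤ W := Finset.sum_nonneg fun i _ => hω i
  have hS0 : 0 ≤ S := Finset.sum_nonneg fun i _ => mul_nonneg (monomialNorm_nonneg k v i) (hω i)
  have hN0 : 0 ≤ detNorm B v := norm_nonneg _
  -- The bound `1 / 2` keeps the eigenvalue in the chart with `‖t‖ ≤ 2 δ`, and `ρ / 2` turns this
  -- into `‖t‖ < ρ`.
  refine ⟨min (1 / 2) (ρ / 2), by positivity, fun δ hδ κ hκ => ?_⟩
  have hδ1 : δ < 1 / 2 := hδ.trans_le (min_le_left _ _)
  have hδ2 : δ < ρ / 2 := hδ.trans_le (min_le_right _ _)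
  obtain ⟨η, hη, hηκ⟩ : ∃ η > 0, (detNorm B v * S + η * (W + C * W)) / ‖a‖ < κ := by
    have hc : Continuous fun η : ℝ => (detNorm B v * S + η * (W + C * W)) / ‖a‖ := by fun_prop
    have ht := (hc.tendsto 0).mono_left (nhdsWithin_le_nhds (s := Set.Ioi 0))
    have hlt : (detNorm B v * S + 0 * (W + C * W)) / ‖a‖ < κ := by
      convert hκ using 1; ring
    obtain ⟨η, h1, h2⟩ := ((ht.eventually (gt_mem_nhds hlt)).and self_mem_nhdsWithin).exists
    exact ⟨η, h2, h1⟩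
  -- The radius `ρ'` depends on `η`, hence on `κ`, while `δ` is already fixed. The Lipschitz bound
  -- `‖t‖ ≤ C W ε` brings `t` below `ρ'` for small `ε`.
  obtain ⟨ρ', hρ', H'⟩ := eventually_norm_linearization_le hf h0 hη
  have hsmall : ∀ c r : ℝ, 0 < r → ∀ᶠ ε in 𝓝[>] (0 : ℝ), c * ε < r := by
    intro c r hr
    have hc : Continuous fun ε : ℝ => c * ε := by fun_prop
    exact (hc.tendsto 0).mono_left nhdsWithin_le_nhds |>.eventually
      (gt_mem_nhds (by simpa using hr))
  filter_upwards [hsmall W ρ hρ, hsmall W ρ' hρ', hsmall (C * W) ρ' hρ', self_mem_nhdsWithin]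
    with ε h1 h2 h3 hε
  have hε : 0 < ε := hε
  refine lt_of_le_of_lt (Real.sSup_le ?_ (by positivity)) hηκ
  rintro _ ⟨E, v', hE, hv', hχ, rfl⟩
  obtain ⟨c, t, hc, rfl⟩ := exists_eq_smul_add_smul_perp hv (hχ.trans (hδ1.trans (by norm_num)))
  rw [isEigenvalue_smul_iff _ hc, isEigenvalue_add_smul_perp_iff _ hv] at hv'
  have hEn : ‖E‖ ≤ W * ε := by
    refine (pi_norm_le_iff_of_nonneg (by positivity)).2 fun i => (hE i).trans ?_
    rw [mul_comm]
    exact mul_le_mul_of_nonneg_right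
      (Finset.single_le_sum (fun i _ => hω i) (Finset.mem_univ i)) hε.le
  have htρ : ‖t‖ < ρ := by
    have := norm_le_two_mul_of_chordalDist_lt hv hc hδ1.le hχ
    linarith
  have ht : ‖t‖ ≤ C * W * ε := by
    have := H E t (hEn.trans_lt h1) htρ hv'
    nlinarith
  have hL := H' E t (hEn.trans_lt h2) (ht.trans_lt h3) hv'
  have hl : ‖detDeriv B v E‖ ≤ detNorm B v * S * ε := by
    refine (norm_detDeriv_le B v E).trans ?_
    rw [mul_assoc]
    refine mul_le_mul_of_nonneg_left ?_ hN0
    rw [hS, Finset.sum_mul]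
    refine Finset.sum_le_sum fun i _ => ?_
    rw [mul_assoc, mul_comm (ω i)]
    exact mul_le_mul_of_nonneg_left (hE i) (monomialNorm_nonneg k v i)
  rw [div_le_div_iff₀ hε ha']
  have h4 := chordalDist_smul_add_smul_perp_le hv hc t
  have h5 : η * (‖E‖ + ‖t‖) ≤ η * (W * ε + C * W * ε) :=
    mul_le_mul_of_nonneg_left (add_le_add hEn ht) (le_of_lt hη)
  nlinarith

/-- Asymptotic lower bound, from the implicit function along a worst perturbation. -/
theorem eventually_lt_sSup_chordalQuotients {n k : ℕ} {B : Coeffs n k} {ω : Fin (k + 1) → ℝ}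
    (hω : ∀ i, 0 ≤ ω i) {v : EuclideanSpace ℂ (Fin 2)} (hv : v ≠ 0) {a : ℂ} (ha : a ≠ 0)
    (hd : HasDerivAt (fun t => chartDet v (B, t)) a 0) (h0 : chartDet v (B, 0) = 0)
    {δ : ℝ} (hδ : 0 < δ) {κ : ℝ}
    (hκ : κ < (∑ i, monomialNorm k v i * ω i) * (detNorm B v / ‖a‖)) :
    ∀ᶠ ε in 𝓝[>] (0 : ℝ), κ < sSup (chordalQuotients B ω v δ ε) := by
  obtain ⟨τ, hτ, hz, hdτ⟩ :=
    exists_implicit_of_hasStrictFDerivAt (hasStrictFDerivAt_chartDet hd) ha h0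
  obtain ⟨E, hE, hL⟩ := exists_detDeriv_eq B v ω hω
  have hline : Tendsto (fun ε : ℝ => B + (ε : ℂ) • E) (𝓝[>] 0) (𝓝 B) := by
    have hc : Continuous fun ε : ℝ => B + (ε : ℂ) • E := by fun_prop
    have := (hc.tendsto 0).mono_left (nhdsWithin_le_nhds (s := Set.Ioi 0))
    simpa using this
  have ht0 : Tendsto (fun ε : ℝ => ‖τ (B + (ε : ℂ) • E)‖) (𝓝[>] 0) (𝓝 0) := by
    have := (hdτ.continuousAt.tendsto.comp hline).norm
    simpa [hτ] using this
  -- The complex difference quotient along `E` is restricted to positive real `ε`.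
  have hof : Tendsto (fun ε : ℝ => (ε : ℂ)) (𝓝[>] 0) (𝓝[≠] 0) := by
    refine tendsto_nhdsWithin_iff.2 ⟨?_, ?_⟩
    · have := (Complex.continuous_ofReal.tendsto 0).mono_left (nhdsWithin_le_nhds (s := Set.Ioi 0))
      simpa using this
    · filter_upwards [self_mem_nhdsWithin] with ε hε
      simpa using (ne_of_gt hε)
  have hq : Tendsto (fun ε : ℝ => ‖τ (B + (ε : ℂ) • E)‖ / ε) (𝓝[>] 0)
      (𝓝 ((∑ i, monomialNorm k v i * ω i) * (detNorm B v / ‖a‖))) := by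
    have h1 := ((hasLineDerivAt_iff_tendsto_slope_zero.1 (hdτ.hasLineDerivAt E)).comp hof).norm
    have h2 : ‖(-a⁻¹ • detDeriv B v) E‖ =
        (∑ i, monomialNorm k v i * ω i) * (detNorm B v / ‖a‖) := by
      rw [smul_apply, norm_smul, norm_neg, norm_inv, hL]; ring
    rw [h2] at h1
    refine h1.congr' ?_
    filter_upwards [self_mem_nhdsWithin] with ε hε
    rw [Function.comp_apply, hτ, sub_zero, norm_smul, norm_inv, Complex.norm_real,
      Real.norm_of_nonneg (le_of_lt hε), div_eq_inv_mul]
  have hχ : Tendsto (fun ε : ℝ => chordalDist v (v + τ (B + (ε : ℂ) • E) • perp v) / ε) (𝓝[>] 0)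
      (𝓝 ((∑ i, monomialNorm k v i * ω i) * (detNorm B v / ‖a‖))) := by
    have h1 : Tendsto (fun ε : ℝ => Real.sqrt (1 + ‖τ (B + (ε : ℂ) • E)‖ ^ 2)) (𝓝[>] 0) (𝓝 1) := by
      have := ((ht0.pow 2).const_add 1).sqrt
      simpa using this
    have h2 := hq.div h1 one_ne_zero
    rw [div_one] at h2
    refine h2.congr fun ε => ?_
    have h3 := chordalDist_smul_add_smul_perp hv one_ne_zero (τ (B + (ε : ℂ) • E))
    rw [one_smul] at h3
    rw [h3, Pi.div_apply, div_right_comm]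
  filter_upwards [hline.eventually hz, ht0.eventually (gt_mem_nhds hδ),
    hχ.eventually (lt_mem_nhds hκ), self_mem_nhdsWithin] with ε h1 h2 h3 hε
  have hε : 0 < ε := hε
  refine h3.trans_le (le_csSup (bddAbove_chordalQuotients B ω v δ hε) ⟨(ε : ℂ) • E, _, fun i => ?_,
    (isEigenvalue_add_smul_perp_iff _ hv _).2 h1, ?_, rfl⟩)
  · rw [Pi.smul_apply, norm_smul, Complex.norm_real, Real.norm_of_nonneg hε.le]
    exact mul_le_mul_of_nonneg_left (hE i) hε.le
  · have h4 := chordalDist_smul_add_smul_perp_le hv one_ne_zero (τ (B + (ε : ℂ) • E))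
    rw [one_smul] at h4
    exact h4.trans_lt h2

/-- The two asymptotic bounds give the limit for every small `δ > 0`; any other candidate shares
some `δ` with it, and limits are unique. -/
theorem isStewartSunCond_iff {n k : ℕ} {B : Coeffs n k} {ω : Fin (k + 1) → ℝ}
    (hω : ∀ i, 0 ≤ ω i) {v : EuclideanSpace ℂ (Fin 2)} (hv : v ≠ 0) {a : ℂ} (ha : a ≠ 0)
    (hd : HasDerivAt (fun t => chartDet v (B, t)) a 0) (h0 : chartDet v (B, 0) = 0) (κ : ℝ) :
    IsStewartSunCond B ω v κ ↔
      κ = (∑ i, monomialNorm k v i * ω i) * (detNorm B v / ‖a‖) := by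
  obtain ⟨δ₀, hδ₀, H⟩ := eventually_sSup_chordalQuotients_lt hω hv ha hd h0
  have key : IsStewartSunCond B ω v ((∑ i, monomialNorm k v i * ω i) * (detNorm B v / ‖a‖)) := by
    filter_upwards [self_mem_nhdsWithin, nhdsWithin_le_nhds (gt_mem_nhds hδ₀)] with δ hδ hδ'
    exact tendsto_order.2 ⟨fun κ' h => eventually_lt_sSup_chordalQuotients hω hv ha hd h0 hδ h,
      fun κ' h => H δ hδ' κ' h⟩
  refine ⟨fun h => ?_, fun h => h ▸ key⟩
  obtain ⟨δ, h1, h2⟩ := (h.and key).exists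
  exact tendsto_nhds_unique h1 h2

theorem isDedieuTisseurCond_iff {n k : ℕ} {B : Coeffs n k} {ω : Fin (k + 1) → ℝ}
    (hω : ∀ i, 0 ≤ ω i) {v : EuclideanSpace ℂ (Fin 2)} (hv : v ≠ 0) {a : ℂ} (ha : a ≠ 0)
    (hd : HasDerivAt (fun t => chartDet v (B, t)) a 0) (h0 : chartDet v (B, 0) = 0) (κ : ℝ) :
    IsDedieuTisseurCond B ω v κ ↔
      κ = Real.sqrt (∑ i, (monomialNorm k v i * ω i) ^ 2) * (detNorm B v / ‖a‖) := by
  have hl := isLUB_conditionOperator B hω hv a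
  simp only [IsDedieuTisseurCond, isConditionOperator_iff hv ha hd h0, exists_eq_left]
  exact ⟨fun h => h.unique hl, fun h => h ▸ hl⟩

end HomMatPoly

end

theorem theorem3p2 (n k : ℕ) (B : HomMatPoly.Coeffs n k) (ω : Fin (k + 1) → ℝ)
    (hω : ∀ i, 0 ≤ ω i) (v : EuclideanSpace ℂ (Fin 2)) (hv : HomMatPoly.IsSimpleEigenvalue B v) :
    (∃! κ_h : ℝ, HomMatPoly.IsDedieuTisseurCond B ω v κ_h) ∧
    (∃! κ_θ : ℝ, HomMatPoly.IsStewartSunCond B ω v κ_θ) ∧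
    ∀ κ_h κ_θ : ℝ, HomMatPoly.IsDedieuTisseurCond B ω v κ_h →
      HomMatPoly.IsStewartSunCond B ω v κ_θ →
      κ_h =
        Real.sqrt (∑ i : Fin (k + 1),
            ‖v 0‖ ^ (2 * (i : ℕ)) * ‖v 1‖ ^ (2 * (k - (i : ℕ))) * ω i ^ 2) /
          (∑ i : Fin (k + 1), ‖v 0‖ ^ (i : ℕ) * ‖v 1‖ ^ (k - (i : ℕ)) * ω i) * κ_θ := by
  obtain ⟨a, ha, hd, h0⟩ := hv.exists_hasDerivAt
  simp only [HomMatPoly.isDedieuTisseurCond_iff hω hv.1 ha hd h0,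
    HomMatPoly.isStewartSunCond_iff hω hv.1 ha hd h0]
  refine ⟨⟨_, rfl, fun _ h => h⟩, ⟨_, rfl, fun _ h => h⟩, ?_⟩
  rintro _ _ rfl rfl
  have h1 : ∀ i : Fin (k + 1), ‖v 0‖ ^ (2 * (i : ℕ)) * ‖v 1‖ ^ (2 * (k - (i : ℕ))) * ω i ^ 2 =
      (HomMatPoly.monomialNorm k v i * ω i) ^ 2 := fun i => by
    rw [HomMatPoly.monomialNorm]; ring
  simp only [h1]
  change _ = _ / (∑ i, HomMatPoly.monomialNorm k v i * ω i) * _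
  have hn : ∀ i ∈ Finset.univ, 0 ≤ HomMatPoly.monomialNorm k v i * ω i := fun i _ =>
    mul_nonneg (HomMatPoly.monomialNorm_nonneg k v i) (hω i)
  -- If the denominator vanishes, every `m_i ω_i` is zero, so `κ_h = 0` agrees with division by
  -- zero.
  by_cases hS : ∑ i, HomMatPoly.monomialNorm k v i * ω i = 0
  · have h2 := (Finset.sum_eq_zero_iff_of_nonneg hn).1 hS
    have h3 : ∑ i, (HomMatPoly.monomialNorm k v i * ω i) ^ 2 = 0 :=
      Finset.sum_eq_zero fun i hi => by rw [h2 i hi]; norm_num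
    rw [h3, Real.sqrt_zero]; simp
  · rw [← mul_assoc, div_mul_cancel₀ _ hS]
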